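/- Let $p$ be a selective ultrafilter, i.e. a free ultrafilter on $\omega$ such that every function $\omega\to\omega$ is finite-to-one or constant on some member of $p$, and every finite-to-one function $\omega\to\omega$ is one-to-one on some member of $p$. For an abelian group $\mathbb G$ let $\mathsf{ult}_p(\mathbb G)=\mathbb G^\omega/{\equiv}$, where $f\equiv g$ iff $\{n: f(n)=g(n)\}\in p$. Put $\mathsf{ult}_p^0(\mathbb G)=\mathbb G$ and, for every ordinal $\alpha>0$, $$\mathsf{ult}_p^\alpha(\mathbb G)=\mathsf{ult}_p\Bigl(\varinjlim_{\beta<\alpha}\mathsf{ult}_p^\beta(\mathbb G)\Bigr),$$ where, for $\delta<\beta$, the map $\mathsf{ult}_p^\delta(\mathbb G)\to\mathsf{ult}_p^\beta(\mathbb G)$ of the direct system sends $a$ to the class of the constant sequence whose value is the image of $a$ in $\varinjlim_{\gamma<\beta}\mathsf{ult}_p^\gamma(\mathbb G)$. Every homomorphism $\Phi:\mathbb G\to\mathbb T=\mathbb R/\mathbb Z$ extends recursively to homomorphisms $\overline\Phi:\mathsf{ult}_p^\alpha(\mathbb G)\to\mathbb T$ by $\overline\Phi([f])=p\text{-}\lim_{n}\overline\Phi(f(n))$.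 Endow $\mathsf{ult}_p^{\omega_1}(\mathbb G)$ with the weakest topology making all $\overline\Phi$, $\Phi\in\mathrm{Hom}(\mathbb G,\mathbb T)$, continuous, and let $\mathsf{Ult}_p^{\omega_1}(\mathbb G)=\mathsf{ult}_p^{\omega_1}(\mathbb G)/K$ with the quotient topology, where $K=\bigcap_{\Phi\in\mathrm{Hom}(\mathbb G,\mathbb T)}\ker\overline\Phi$. Let $[\omega]^{<\omega}$ be the group of finite subsets of $\omega$ with the symmetric difference. Then $\mathsf{Ult}_p^{\omega_1}([\omega]^{<\omega})$ is a Hausdorff topological group in which $x+x=0$ for every $x$; it is $p$-compact, i.e. for every sequence $(x_n)_{n\in\omega}$ there is a point $x$ such that $\{n: x_n\in U\}\in p$ for every open $U\ni x$; and it has no non-trivial convergent sequences, i.e. every convergent sequence is eventually constant. -/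

import Mathlib

noncomputable section

open Filter Topology CategoryTheory

namespace IteratedUltrapower

/-! ### Ultrafilters on `ω` -/

/-- Every function on `ω` is constant or finite-to-one on some member of `p`. -/
def IsPPoint (p : Ultrafilter ℕ) : Prop :=
  ∀ f : ℕ → ℕ, ∃ U ∈ p, (∃ c, ∀ n ∈ U, f n = c) ∨ ∀ m, {n | n ∈ U ∧ f n = m}.Finite

/-- Every finite-to-one function on `ω` is one-to-one on some member of `p`. -/
def IsQPoint (p : Ultrafilter ℕ) : Prop :=
  ∀ f : ℕ → ℕ, (∀ m, {n | f n = m}.Finite) → ∃ U ∈ p, Set.InjOn f U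

/-- A selective ultrafilter: a free ultrafilter on `ω` that is a P-point and a Q-point. -/
structure IsSelective (p : Ultrafilter ℕ) : Prop where
  free : (p : Filter ℕ) ≤ cofinite
  isPPoint : IsPPoint p
  isQPoint : IsQPoint p

/-! ### Topological notions -/

/-- Every sequence of points of `X` has a `p`-limit in `X`. -/
def IsPCompact (p : Ultrafilter ℕ) (X : Type) [TopologicalSpace X] : Prop :=
  ∀ x : ℕ → X, ∃ a, Tendsto x (p : Filter ℕ) (𝓝 a)

/-- `X` has no non-trivial convergent sequences: a sequence that converges to `a` is
eventually equal to `a`. -/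
def NoNontrivialConvergentSeq (X : Type) [TopologicalSpace X] : Prop :=
  ∀ (x : ℕ → X) (a : X), Tendsto x atTop (𝓝 a) → ∀ᶠ n in atTop, x n = a

/-! ### The ultrapower of an abelian group -/

/-- The ultrapower `ult_p(G) = G^ω / ≡`, where `f ≡ g` iff `{n | f n = g n} ∈ p`. -/
abbrev Ultrapower (p : Ultrafilter ℕ) (G : Type) : Type := Germ (p : Filter ℕ) G

/-- The canonical embedding `G → ult_p(G)`: constant sequences. -/
def constHom (p : Ultrafilter ℕ) (G : Type) [AddCommGroup G] : G →+ Ultrapower p G where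
  toFun g := ((fun _ => g : ℕ → G) : Ultrapower p G)
  map_zero' := rfl
  map_add' _ _ := rfl

theorem tendsto_limUnder (p : Ultrafilter ℕ) (x : ℕ → UnitAddCircle) :
    Tendsto x (p : Filter ℕ) (𝓝 (limUnder (p : Filter ℕ) x)) := by
  obtain ⟨a, -, ha⟩ := isCompact_univ.ultrafilter_le_nhds (p.map x) (by simp)
  exact tendsto_nhds_limUnder ⟨a, ha⟩

/-- The extension of a homomorphism `Φ : G → 𝕋 = ℝ/ℤ` to the ultrapower `ult_p(G)`, given by
`[f] ↦ p-lim Φ (f n)`. -/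
def ultrapowerExt (p : Ultrafilter ℕ) {G : Type} [AddCommGroup G] (Φ : G →+ UnitAddCircle) :
    Ultrapower p G →+ UnitAddCircle where
  toFun x := Quotient.liftOn x (fun f => limUnder (p : Filter ℕ) fun n => Φ (f n))
    (fun f g (h : f =ᶠ[(p : Filter ℕ)] g) => by
      have : (fun n => Φ (f n)) =ᶠ[(p : Filter ℕ)] fun n => Φ (g n) :=
        h.mono fun n hn => congrArg Φ hn
      simp only [limUnder, Filter.map_congr this])
  map_zero' := by
    refine Tendsto.limUnder_eq (f := (p : Filter ℕ)) ?_
    simp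
  map_add' := by
    rintro ⟨f⟩ ⟨g⟩
    refine Tendsto.limUnder_eq (f := (p : Filter ℕ)) ?_
    simp only [map_add]
    exact (tendsto_limUnder p fun n => Φ (f n)).add (tendsto_limUnder p fun n => Φ (g n))

theorem ultrapowerExt_coe (p : Ultrafilter ℕ) {G : Type} [AddCommGroup G]
    (Φ : G →+ UnitAddCircle) (f : ℕ → G) :
    ultrapowerExt p Φ (f : Ultrapower p G) = limUnder (p : Filter ℕ) fun n => Φ (f n) := rfl

theorem ultrapowerExt_const (p : Ultrafilter ℕ) {G : Type} [AddCommGroup G]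
    (Φ : G →+ UnitAddCircle) (g : G) : ultrapowerExt p Φ (constHom p G g) = Φ g :=
  Tendsto.limUnder_eq (f := (p : Filter ℕ)) tendsto_const_nhds

/-! ### The iterated ultrapowers

Fix a well-ordered set `I`; its elements play the role of the ordinals below the order type
of `I`. By recursion on `i : I` we construct the groups `ult i` and the canonical maps
`φ j i : ult j → ult i` for `j ≤ i`, so that

* `ult i = G` if `i` is the least element of `I`,
* `ult i = ult_p (lim_{j < i} ult j)` otherwise, and
* `φ j i a` is the class of the constant sequence with value (the image in `lim_{j < i} ult j` of)
  `a`, for `j < i`.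

These three facts are `ultEquivBot`, `ultEquiv` and `ultEquiv_φ` below. -/

variable {I : Type} [LinearOrder I]

/-- What the recursion produces at one step: a group, and the canonical maps into it from the
groups of the earlier steps. Only the map `fromStage j Y` where `Y` is the group of the
`j`-th step matters; it is zero for all other `Y`. -/
structure Stage (I : Type) : Type 1 where
  carrier : AddCommGrpCat.{0}
  fromStage : I → ∀ Y : AddCommGrpCat.{0}, Y →+ carrier

/-- The canonical map from the group of step `j` to that of step `k`, for `j ≤ k`, where `S`
and `T` are the outcomes of these steps; it is the identity if `j = k`. -/
def transition (j k : I) (S T : Stage I) : S.carrier →+ T.carrier :=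
  open Classical in
  if h : j = k ∧ S.carrier = T.carrier then (eqToHom h.2).hom else T.fromStage j S.carrier

/-- The direct limit of the groups constructed before step `i`. -/
abbrev stageLim (i : I) (d : {j // j < i} → Stage I) : Type :=
  AddCommGroup.DirectLimit (fun j => (d j).carrier)
    (fun j k _ => transition j.1 k.1 (d j) (d k))

/-- One step of the recursion. -/
def stageStep (p : Ultrafilter ℕ) (G : Type) [AddCommGroup G] (i : I)
    (d : {j // j < i} → Stage I) : Stage I :=
  open Classical in
  if IsMin i then ⟨AddCommGrpCat.of G, fun _ _ => 0⟩
  else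
    { carrier := AddCommGrpCat.of (Ultrapower p (stageLim i d))
      fromStage := fun j Y =>
        if h : ∃ hj : j < i, Y = (d ⟨j, hj⟩).carrier then
          ((constHom p (stageLim i d)).comp
            (AddCommGroup.DirectLimit.of (fun j => (d j).carrier)
              (fun j k _ => transition j.1 k.1 (d j) (d k)) ⟨j, h.1⟩)).comp (eqToHom h.2).hom
        else 0 }

variable [WellFoundedLT I]

/-- The recursion. -/
def stage (p : Ultrafilter ℕ) (G : Type) [AddCommGroup G] : I → Stage I :=
  (wellFounded_lt (α := I)).fix fun i d => stageStep p G i fun j => d j.1 j.2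

theorem stage_eq (p : Ultrafilter ℕ) (G : Type) [AddCommGroup G] (i : I) :
    stage p G i = stageStep p G i fun j => stage p G j.1 :=
  (wellFounded_lt (α := I)).fix_eq _ i

/-- The `i`-th iterated ultrapower of `G`. -/
def ult (p : Ultrafilter ℕ) (G : Type) [AddCommGroup G] (i : I) : Type :=
  (stage p G i).carrier

instance ultAddCommGroup (p : Ultrafilter ℕ) (G : Type) [AddCommGroup G] (i : I) :
    AddCommGroup (ult p G i) :=
  inferInstanceAs (AddCommGroup (stage p G i).carrier)

/-- The canonical map `ult j → ult i`, for `j ≤ i`. -/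
def φ (p : Ultrafilter ℕ) (G : Type) [AddCommGroup G] (j i : I) : ult p G j →+ ult p G i :=
  transition j i (stage p G j) (stage p G i)

/-- `lim_{j < i} ult j`, the direct limit along the canonical maps. -/
abbrev ultLim (p : Ultrafilter ℕ) (G : Type) [AddCommGroup G] (i : I) : Type :=
  AddCommGroup.DirectLimit (fun j : {j // j < i} => ult p G j.1) (fun j k _ => φ p G j.1 k.1)

/-- The canonical map `ult j → lim_{k < i} ult k`, for `j < i`. -/
abbrev toLim (p : Ultrafilter ℕ) (G : Type) [AddCommGroup G] (i : I) (j : {j // j < i}) :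
    ult p G j.1 →+ ultLim p G i :=
  AddCommGroup.DirectLimit.of (fun j : {j // j < i} => ult p G j.1) (fun j k _ => φ p G j.1 k.1) j

theorem stage_of_isMin (p : Ultrafilter ℕ) (G : Type) [AddCommGroup G] {i : I} (hi : IsMin i) :
    stage p G i = ⟨AddCommGrpCat.of G, fun _ _ => 0⟩ := by
  rw [stage_eq, stageStep, if_pos hi]

theorem stage_of_not_isMin (p : Ultrafilter ℕ) (G : Type) [AddCommGroup G] {i : I}
    (hi : ¬ IsMin i) :
    stage p G i =
      { carrier := AddCommGrpCat.of (Ultrapower p (ultLim p G i))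
        fromStage := fun j Y =>
          open Classical in
          if h : ∃ _ : j < i, Y = (stage p G j).carrier then
            ((constHom p (ultLim p G i)).comp (toLim p G i ⟨j, h.1⟩)).comp (eqToHom h.2).hom
          else 0 } := by
  rw [stage_eq, stageStep, if_neg hi]
  rfl

/-- `ult i = G` if `i` is the least element of `I`. -/
def ultEquivBot (p : Ultrafilter ℕ) (G : Type) [AddCommGroup G] {i : I} (hi : IsMin i) :
    ult p G i ≃+ G :=
  (eqToIso (congrArg Stage.carrier (stage_of_isMin p G hi))).addCommGroupIsoToAddEquiv

/-- `ult i = ult_p (lim_{j < i} ult j)` if `i` is not the least element of `I`. -/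
def ultEquiv (p : Ultrafilter ℕ) (G : Type) [AddCommGroup G] {i : I} (hi : ¬ IsMin i) :
    ult p G i ≃+ Ultrapower p (ultLim p G i) :=
  (eqToIso (congrArg Stage.carrier (stage_of_not_isMin p G hi))).addCommGroupIsoToAddEquiv

theorem φ_self (p : Ultrafilter ℕ) (G : Type) [AddCommGroup G] (i : I) (a : ult p G i) :
    φ p G i i a = a := by
  simp [φ, transition]
  rfl

/-- For `j < i`, the map `φ j i` sends `a` to the class of the constant sequence `a`. -/
theorem ultEquiv_φ (p : Ultrafilter ℕ) (G : Type) [AddCommGroup G] {j i : I} (hji : j < i)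
    (a : ult p G j) :
    ultEquiv p G hji.not_isMin (φ p G j i a) = constHom p _ (toLim p G i ⟨j, hji⟩ a) := by
  have key : ∀ (S : Stage I) (h : stage p G i = S),
      (eqToHom (congrArg Stage.carrier h)).hom (φ p G j i a) =
        S.fromStage j (stage p G j).carrier a := by
    rintro _ rfl
    simp [φ, transition, hji.ne]
    rfl
  refine (key _ (stage_of_not_isMin p G hji.not_isMin)).trans ?_
  simp [hji]
  rfl

/-- The groups `ult i` and the maps `φ` form a direct system. -/
theorem φ_φ (p : Ultrafilter ℕ) (G : Type) [AddCommGroup G] {j k i : I} (hjk : j ≤ k)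
    (hki : k ≤ i) (a : ult p G j) : φ p G k i (φ p G j k a) = φ p G j i a := by
  rcases hki.eq_or_lt with rfl | hki
  · exact φ_self ..
  have hji := hjk.trans_lt hki
  apply (ultEquiv p G hji.not_isMin).injective
  rw [ultEquiv_φ p G hki, ultEquiv_φ p G hji]
  exact congrArg (constHom p _) (AddCommGroup.DirectLimit.of_f
    (f := fun (j k : {j // j < i}) _ => φ p G j.1 k.1) (i := ⟨j, hji⟩) (j := ⟨k, hki⟩) hjk a)

/-! ### The extensions of homomorphisms to the iterated ultrapowers -/

/-- The compatibility of homomorphisms `Ψ j : ult j → 𝕋`, `j < i`, with the canonical maps. -/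
def Compat (p : Ultrafilter ℕ) (G : Type) [AddCommGroup G] (i : I)
    (Ψ : ∀ j : {j // j < i}, ult p G j.1 →+ UnitAddCircle) : Prop :=
  ∀ (j k : {j // j < i}) (_ : j ≤ k) (a : ult p G j.1), Ψ k (φ p G j.1 k.1 a) = Ψ j a

/-- The homomorphism `lim_{j < i} ult j → 𝕋` given by compatible homomorphisms `ult j → 𝕋`. -/
def limExt (p : Ultrafilter ℕ) (G : Type) [AddCommGroup G] (i : I)
    (Ψ : ∀ j : {j // j < i}, ult p G j.1 →+ UnitAddCircle) (h : Compat p G i Ψ) :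
    ultLim p G i →+ UnitAddCircle :=
  AddCommGroup.DirectLimit.lift (fun j : {j // j < i} => ult p G j.1)
    (fun j k _ => φ p G j.1 k.1) UnitAddCircle Ψ h

/-- The extension `Φ̄ : ult i → 𝕋` of `Φ : G → 𝕋`, by recursion on `i`: it is `Φ` if `i` is
the least element, and `Φ̄ [f] = p-lim Φ̄ (f n)` otherwise. The case that the extensions are not
compatible with the canonical maps does not occur, see `compat_ext`. -/
def ext (p : Ultrafilter ℕ) {G : Type} [AddCommGroup G] (Φ : G →+ UnitAddCircle) :
    ∀ i : I, ult p G i →+ UnitAddCircle :=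
  (wellFounded_lt (α := I)).fix fun i Ψ =>
    open Classical in
    if hi : IsMin i then Φ.comp (ultEquivBot p G hi).toAddMonoidHom
    else if h : Compat p G i (fun j => Ψ j.1 j.2) then
      (ultrapowerExt p (limExt p G i _ h)).comp (ultEquiv p G hi).toAddMonoidHom
    else 0

theorem ext_eq (p : Ultrafilter ℕ) {G : Type} [AddCommGroup G] (Φ : G →+ UnitAddCircle) (i : I) :
    ext p Φ i =
      open Classical in
      if hi : IsMin i then Φ.comp (ultEquivBot p G hi).toAddMonoidHom
      else if h : Compat p G i (fun j => ext p Φ j.1) then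
        (ultrapowerExt p (limExt p G i _ h)).comp (ultEquiv p G hi).toAddMonoidHom
      else 0 :=
  (wellFounded_lt (α := I)).fix_eq _ i

theorem compat_ext (p : Ultrafilter ℕ) {G : Type} [AddCommGroup G] (Φ : G →+ UnitAddCircle)
    (i : I) : Compat p G i (fun j => ext p Φ j.1) := by
  induction i using (wellFounded_lt (α := I)).induction with
  | _ i ih =>
    rintro ⟨j, hj⟩ ⟨k, hk⟩ hjk a
    rcases (show j ≤ k from hjk).eq_or_lt with rfl | hjk
    · exact congrArg _ (φ_self p G j a)
    · change ext p Φ k (φ p G j k a) = ext p Φ j a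
      rw [ext_eq p Φ k, dif_neg hjk.not_isMin, dif_pos (ih k hk)]
      change ultrapowerExt p _ (ultEquiv p G hjk.not_isMin (φ p G j k a)) = _
      rw [ultEquiv_φ p G hjk, ultrapowerExt_const]
      exact AddCommGroup.DirectLimit.lift_of ..

/-- `Φ̄` is `Φ` on `ult_p^0(G) = G`. -/
theorem ext_of_isMin (p : Ultrafilter ℕ) {G : Type} [AddCommGroup G] (Φ : G →+ UnitAddCircle)
    {i : I} (hi : IsMin i) (a : ult p G i) : ext p Φ i a = Φ (ultEquivBot p G hi a) := by
  rw [ext_eq, dif_pos hi]; rfl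

/-- `Φ̄ [f] = p-lim Φ̄ (f n)` for `f : ω → lim_{j < i} ult j`. -/
theorem ext_of_not_isMin (p : Ultrafilter ℕ) {G : Type} [AddCommGroup G]
    (Φ : G →+ UnitAddCircle) {i : I} (hi : ¬ IsMin i) (f : ℕ → ultLim p G i) :
    ext p Φ i ((ultEquiv p G hi).symm (f : Ultrapower p (ultLim p G i))) =
      limUnder (p : Filter ℕ) fun n => limExt p G i _ (compat_ext p Φ i) (f n) := by
  rw [ext_eq, dif_neg hi, dif_pos (compat_ext p Φ i)]
  change ultrapowerExt p _ (ultEquiv p G hi ((ultEquiv p G hi).symm _)) = _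
  rw [AddEquiv.apply_symm_apply, ultrapowerExt_coe]

/-! ### The group `Ult_p^{ω₁}(G)` -/

/-- The ordinals `≤ ω₁`. -/
abbrev OmegaOneIndex : Type := WithTop (Ordinal.omega 1 : Ordinal.{0}).ToType

/-- The group `ult_p^{ω₁}(G)`. -/
def UltOmegaOne (p : Ultrafilter ℕ) (G : Type) [AddCommGroup G] : Type :=
  ult p G (⊤ : OmegaOneIndex)

instance ultOmegaOneAddCommGroup (p : Ultrafilter ℕ) (G : Type) [AddCommGroup G] :
    AddCommGroup (UltOmegaOne p G) :=
  inferInstanceAs (AddCommGroup (ult p G (⊤ : OmegaOneIndex)))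

/-- The extension `Φ̄ : ult_p^{ω₁}(G) → 𝕋` of `Φ : G → 𝕋`. -/
def extOmegaOne (p : Ultrafilter ℕ) {G : Type} [AddCommGroup G] (Φ : G →+ UnitAddCircle) :
    UltOmegaOne p G →+ UnitAddCircle :=
  ext p Φ (⊤ : OmegaOneIndex)

/-- The extended Bohr topology: the weakest topology that makes every `Φ̄` continuous. -/
instance extendedBohr (p : Ultrafilter ℕ) (G : Type) [AddCommGroup G] :
    TopologicalSpace (UltOmegaOne p G) :=
  ⨅ Φ : G →+ UnitAddCircle, TopologicalSpace.induced (extOmegaOne p Φ) inferInstance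

/-- The intersection `K` of the kernels of all `Φ̄`. -/
def commonKernel (p : Ultrafilter ℕ) (G : Type) [AddCommGroup G] : AddSubgroup (UltOmegaOne p G) :=
  ⨅ Φ : G →+ UnitAddCircle, (extOmegaOne p Φ).ker

/-- `Ult_p^{ω₁}(G) = ult_p^{ω₁}(G) / K`, with the quotient group structure and the quotient
topology of Mathlib. -/
abbrev HausdorffUlt (p : Ultrafilter ℕ) (G : Type) [AddCommGroup G] : Type :=
  UltOmegaOne p G ⧸ commonKernel p G

/-- The group `[ω]^{<ω}` of finite subsets of `ω`, with the symmetric difference as addition. -/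
abbrev FinSubsets : Type := AsBoolRing (Finset ℕ)

end IteratedUltrapower

end

noncomputable section

open Filter Topology CategoryTheory

namespace IteratedUltrapower

/-! The map `v ↦ (Φ ↦ Φ̄ v)` embeds `Ult_p^{ω₁}(G)` as a topological group into a power of `𝕋`
(`isEmbedding_hausdorffEval`), which is Hausdorff. Every element of a non-minimal stage becomes a
`p`-limit of values from earlier stages, so exponent 2 passes up the stages. Countably many stages
below `ω₁` are bounded below `ω₁`; hence the last stage has no new values and contains all
`p`-limits of its sequences.

A non-trivial convergent sequence would give an infinite countable set `X` of values tending to 0,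
so it suffices to find `Φ` with `Φ̄ = 1/2` infinitely often on `X`
(`IsSelective.exists_hom_ne_zero`). Close `X` and the image of `G` to a countable `𝔽₂`-space `S`
containing, with each `s` outside the image of `G`, a sequence `s_n` from earlier stages with
`p`-limit `s`. A functional `ψ` on `S` with `ψ s_n = ψ s` for `p`-almost all `n`, for each such `s`,
is the extension of its own restriction to `G`, by induction on the stages.

Such a `ψ` is built on finite subspaces (`IsSelective.exists_functional`). Since `s_n - s` has
`p`-limit 0, the spans of finitely many of these differences are, for `p`-almost all `n`,
transversal to the subspace already treated, so `ψ` may be set to 0 there. Selectivity makes the set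
of indices used a member of `p` (`IsSelective.exists_play`). -/

/-! ### Diagonalization along a selective ultrafilter -/

/-- A P-point contains a pseudo-intersection of any sequence of its members. -/
theorem IsPPoint.exists_pseudoIntersection {p : Ultrafilter ℕ} (hp : IsPPoint p)
    {W : ℕ → Set ℕ} (hW : ∀ m, W m ∈ p) :
    ∃ U ∈ p, ∀ m, {n | n ∈ U ∧ n ∉ W m}.Finite := by
  classical
  by_cases hall : (⋂ m, W m) ∈ p
  · refine ⟨_, hall, fun m => ?_⟩
    convert Set.finite_empty
    ext n
    simp only [Set.mem_ofPred_eq, Set.mem_empty_iff_false, iff_false, not_and, not_not]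
    exact fun h => Set.mem_iInter.1 h m
  have hV : (⋂ m, W m)ᶜ ∈ p := Ultrafilter.compl_mem_iff_notMem.2 hall
  have hex : ∀ n ∈ (⋂ m, W m)ᶜ, ∃ m, n ∉ W m := fun n hn => by simpa using hn
  let g : ℕ → ℕ := fun n => if h : ∃ m, n ∉ W m then Nat.find h else 0
  have hg : ∀ n (h : ∃ m, n ∉ W m), n ∉ W (g n) := fun n h => by
    simp only [g, dif_pos h]
    exact Nat.find_spec h
  have hgle : ∀ n m, n ∉ W m → g n ≤ m := fun n m h => by
    have h' : ∃ m, n ∉ W m := ⟨m, h⟩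
    simp only [g, dif_pos h']
    exact Nat.find_min' h' h
  -- If `g` had the constant value `c` on `U`, then `U` would miss `W c` off the intersection,
  -- although `W c ∈ p`.
  obtain ⟨U, hU, ⟨c, hc⟩ | hfin⟩ := hp g
  · obtain ⟨n, ⟨hnU, hnV⟩, hnW⟩ :=
      p.neBot.nonempty_of_mem (inter_mem (inter_mem hU hV) (hW c))
    exact absurd hnW (hc n hnU ▸ hg n (hex n hnV))
  · refine ⟨U, hU, fun m => ?_⟩
    refine ((Set.finite_Iic m).biUnion fun k _ => hfin k).subset ?_
    rintro n ⟨hnU, hn⟩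
    exact Set.mem_biUnion (x := g n) (hgle n m hn) ⟨hnU, rfl⟩

/-- A Q-point has a member that leaves prescribed gaps between its consecutive elements. -/
theorem IsQPoint.exists_sparse {p : Ultrafilter ℕ} (hp : IsQPoint p) (h : ℕ → ℕ) :
    ∃ U ∈ p, ∀ m ∈ U, ∀ n ∈ U, m < n → ∃ k, m ≤ k ∧ h k ≤ n := by
  classical
  -- Endpoints of consecutive blocks `[a k, a (k + 1))`; below, `g n` is the index of the block of
  -- `n`.
  let a : ℕ → ℕ := fun k => Nat.rec 0 (fun _ x => max (x + 1) (h x)) k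
  have ha : StrictMono a := strictMono_nat_of_lt_succ fun k => by
    change a k < max (a k + 1) (h (a k))
    exact lt_max_of_lt_left (Nat.lt_succ_self _)
  have hah : ∀ k, h (a k) ≤ a (k + 1) := fun k => le_max_right _ _
  have hex : ∀ n, ∃ k, n < a (k + 1) := fun n => ⟨n, (Nat.lt_succ_self n).trans_le (ha.id_le _)⟩
  let g : ℕ → ℕ := fun n => Nat.find (hex n)
  have hg1 : ∀ n, n < a (g n + 1) := fun n => Nat.find_spec (hex n)
  have hg0 : ∀ n, a (g n) ≤ n := fun n => by
    rcases hgn : g n with _ | k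
    · exact Nat.zero_le _
    · exact not_lt.1 (Nat.find_min (hex n) (m := k) (by change k < g n; omega))
  have hgmono : Monotone g := fun m n hmn => Nat.find_min' _ (hmn.trans_lt (hg1 n))
  obtain ⟨U, hU, hinj⟩ := hp g fun m =>
    (Set.finite_Iio (a (m + 1))).subset fun n hn => by
      have := hg1 n
      rwa [show g n = m from hn] at this
  -- Each block has at most one point of `U`. Keeping only blocks of one parity leaves a full block
  -- between two points, and the left end of the block after that of `m` serves as `k`.
  have key : ∀ V : Set ℕ, (∀ m ∈ V, ∀ n ∈ V, g m % 2 = g n % 2) →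
      ∀ m ∈ U ∩ V, ∀ n ∈ U ∩ V, m < n → ∃ k, m ≤ k ∧ h k ≤ n := by
    rintro V hV m ⟨hmU, hmV⟩ n ⟨hnU, hnV⟩ hmn
    have h1 : g m ≠ g n := fun e => hmn.ne (hinj hmU hnU e)
    have h2 := hgmono hmn.le
    have h3 := hV m hmV n hnV
    exact ⟨a (g m + 1), (hg1 m).le, (hah (g m + 1)).trans ((ha.monotone
      (show g m + 1 + 1 ≤ g n by omega)).trans (hg0 n))⟩
  by_cases hE : {n | g n % 2 = 0} ∈ p
  · exact ⟨_, inter_mem hU hE, key _ fun m hm n hn => hm.trans hn.symm⟩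
  · refine ⟨_, inter_mem hU (Ultrafilter.compl_mem_iff_notMem.2 hE), key _ fun m hm n hn => ?_⟩
    simp only [Set.mem_compl_iff, Set.mem_ofPred_eq] at hm hn
    omega

/-- A selective ultrafilter contains a diagonal intersection of any sequence of its members. -/
theorem IsSelective.exists_diagonal {p : Ultrafilter ℕ} (hp : IsSelective p)
    {W : ℕ → Set ℕ} (hW : ∀ m, W m ∈ p) :
    ∃ U ∈ p, ∀ m ∈ U, ∀ n ∈ U, m < n → n ∈ W m := by
  classical
  obtain ⟨U, hU, hfin⟩ := hp.isPPoint.exists_pseudoIntersection hW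
  -- A gap reaching past this bound turns the pseudo-intersection into a diagonal intersection.
  have hb : ∀ k, ∃ b, ∀ m ≤ k, ∀ n ∈ U, b ≤ n → n ∈ W m := fun k => by
    obtain ⟨b, hb⟩ := ((Set.finite_Iic k).biUnion fun m _ => hfin m).bddAbove
    refine ⟨b + 1, fun m hm n hn hbn => by_contra fun hnW => ?_⟩
    have := hb (Set.mem_biUnion (x := m) hm ⟨hn, hnW⟩)
    omega
  choose h hh using hb
  obtain ⟨V, hV, hgap⟩ := hp.isQPoint.exists_sparse h
  refine ⟨U ∩ V, inter_mem hU hV, fun m hm n hn hmn => ?_⟩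
  obtain ⟨k, hmk, hkn⟩ := hgap m hm.2 n hn.2 hmn
  exact hh k m hmk n hn.1 hkn

/-- In the game in which one player chooses members `W s` of a selective ultrafilter `p`,
depending on the current state `s` of the game, and the other one replies with elements of these
sets, the latter can play so that the set of all replies is in `p`. -/
theorem IsSelective.exists_play {p : Ultrafilter ℕ} (hp : IsSelective p) {σ : Type*}
    (step : σ → ℕ → σ) (W : σ → Set ℕ) (hW : ∀ s, W s ∈ p) (s₀ : σ) :
    ∃ (u : ℕ → ℕ) (s : ℕ → σ), StrictMono u ∧ Set.range u ∈ p ∧ s 0 = s₀ ∧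
      (∀ k, s (k + 1) = step (s k) (u k)) ∧ ∀ k, u k ∈ W (s k) := by
  classical
  -- `T k` contains all states reachable by increasing replies below `k`; it is finite, so the
  -- corresponding `W s` have their intersection in `p`.
  let T : ℕ → Finset σ := fun k => Nat.rec {s₀} (fun m t => t ∪ t.image fun s => step s m) k
  have hT : ∀ m, T (m + 1) = T m ∪ (T m).image fun s => step s m := fun m => rfl
  have hTmono : Monotone T := monotone_nat_of_le_succ fun m => by
    rw [hT]; exact Finset.subset_union_left
  obtain ⟨U, hU, hdiag⟩ := hp.exists_diagonal (W := fun m => ⋂ s ∈ T (m + 1), W s)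
    fun m => (Filter.biInter_finset_mem _).2 fun s _ => hW s
  -- Diagonality restricts a point only through smaller points of `U`, so the first reply needs `W
  -- s₀` itself.
  have hV : U ∩ W s₀ ∈ p := inter_mem hU (hW s₀)
  have hinf : (U ∩ W s₀).Infinite := fun hf =>
    Ultrafilter.compl_mem_iff_notMem.1 (hp.free hf.compl_mem_cofinite) hV
  let u : ℕ → ℕ := Nat.nth (· ∈ U ∩ W s₀)
  have hu : StrictMono u := Nat.nth_strictMono hinf
  have huV : ∀ k, u k ∈ U ∩ W s₀ := fun k => Nat.nth_mem_of_infinite hinf k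
  let s : ℕ → σ := fun k => Nat.rec s₀ (fun k s => step s (u k)) k
  have hs : ∀ k, s (k + 1) = step (s k) (u k) := fun k => rfl
  have hsT : ∀ k, s (k + 1) ∈ T (u k + 1) := by
    intro k
    rw [hs, hT]
    refine Finset.mem_union_right _ (Finset.mem_image_of_mem (fun s => step s (u k)) ?_)
    induction k with
    | zero => exact hTmono (Nat.zero_le _) (Finset.mem_singleton_self s₀)
    | succ k ih =>
      refine hTmono (show u k + 1 ≤ u (k + 1) from hu (Nat.lt_succ_self k)) ?_
      rw [hs, hT]
      exact Finset.mem_union_right _ (Finset.mem_image_of_mem (fun s => step s (u k)) ih)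
  refine ⟨u, s, hu, ?_, rfl, hs, ?_⟩
  · rw [show Set.range u = U ∩ W s₀ from Nat.range_nth_of_infinite hinf]
    exact hV
  · rintro (_ | k)
    · exact (huV 0).2
    · exact Set.mem_iInter₂.1 (hdiag _ (huV k).1 _ (huV (k + 1)).1 (hu (Nat.lt_succ_self k))) _
        (hsT k)

/-! ### Linear functionals that vanish along the ultrafilter -/

section Functional

variable {K V : Type*} [Field K] [AddCommGroup V] [Module K V]

/-- A linear functional can be modified outside of a subspace `E` so that it vanishes on a
subspace `R` that is transversal to `E` and has value `1` at a given point outside of `E + R`. -/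
theorem exists_functional_extending (E R : Submodule K V) (hER : Disjoint E R) {x : V}
    (hx : x ∉ E ⊔ R) (ψ : V →ₗ[K] K) :
    ∃ ψ' : V →ₗ[K] K, (∀ v ∈ E, ψ' v = ψ v) ∧ (∀ v ∈ R, ψ' v = 0) ∧ ψ' x = 1 := by
  -- The hypotheses say exactly that `E` and `x` stay independent modulo `R`, so `j` has a left
  -- inverse, through which values on `E` and at `x` can be prescribed.
  let j : E × K →ₗ[K] V ⧸ R :=
    (R.mkQ.comp E.subtype).coprod (LinearMap.toSpanSingleton K _ (R.mkQ x))
  have hj : LinearMap.ker j = ⊥ := by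
    rw [LinearMap.ker_eq_bot']
    rintro ⟨⟨e, he⟩, c⟩ h
    have h' : e + c • x ∈ R := by
      rw [← Submodule.Quotient.mk_eq_zero]
      simpa [j] using h
    have hc : c = 0 := by
      by_contra hc
      refine hx ?_
      have : x = c⁻¹ • (-e + (e + c • x)) := by simp [hc]
      rw [this]
      exact Submodule.smul_mem _ _ (add_mem (Submodule.mem_sup_left (neg_mem he))
        (Submodule.mem_sup_right h'))
    subst hc
    have : e = 0 := Submodule.disjoint_def.1 hER e he (by simpa using h')
    simp [this]
  obtain ⟨g, hg⟩ := LinearMap.exists_leftInverse_of_injective j hj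
  have hg' : ∀ y, g (j y) = y := fun y => LinearMap.congr_fun hg y
  refine ⟨(((ψ.comp E.subtype).coprod LinearMap.id).comp g).comp R.mkQ, ?_, ?_, ?_⟩
  · intro v hv
    have : R.mkQ v = j (⟨v, hv⟩, 0) := by simp [j]
    simp only [LinearMap.comp_apply, this, hg']
    simp
  · intro v hv
    have : R.mkQ v = 0 := by simpa using hv
    simp only [LinearMap.comp_apply, this, map_zero]
  · have : R.mkQ x = j (0, 1) := by simp [j]
    simp only [LinearMap.comp_apply, this, hg']
    simp

/-- Functionals that stabilize along an exhausting sequence of subspaces have a limit. -/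
theorem exists_functional_of_stabilizing (E : ℕ → Submodule K V) (hE : Monotone E)
    (hE' : ∀ v, ∃ k, v ∈ E k) (ψ : ℕ → V →ₗ[K] K)
    (hψ : ∀ k, ∀ v ∈ E k, ψ (k + 1) v = ψ k v) :
    ∃ χ : V →ₗ[K] K, ∀ k, ∀ v ∈ E k, χ v = ψ k v := by
  have hst : ∀ k l, k ≤ l → ∀ v ∈ E k, ψ l v = ψ k v := by
    intro k l hkl v hv
    induction l, hkl using Nat.le_induction with
    | base => rfl
    | succ l hkl ih => rw [hψ l v (hE hkl hv), ih]
  choose r hr using hE'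
  have hval : ∀ k, ∀ v ∈ E k, ψ (r v) v = ψ k v := fun k v hv => by
    rcases le_total k (r v) with h | h
    · exact hst _ _ h v hv
    · exact (hst _ _ h v (hr v)).symm
  refine ⟨⟨⟨fun v => ψ (r v) v, fun v w => ?_⟩, fun c v => ?_⟩, hval⟩
  · have hv := hE (le_max_left (r v) (r w)) (hr v)
    have hw := hE (le_max_right (r v) (r w)) (hr w)
    change ψ (r (v + w)) (v + w) = ψ (r v) v + ψ (r w) w
    rw [hval _ _ (add_mem hv hw), hval _ _ hv, hval _ _ hw, map_add]
  · change ψ (r (c • v)) (c • v) = c • ψ (r v) v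
    rw [hval _ _ (Submodule.smul_mem _ c (hr v)), map_smul]

end Functional

/-- Let `v i` be sequences in a countable vector space over a finite field such that no linear
combination of finitely many of them is `p`-almost everywhere equal to a nonzero constant. Then
there is a linear functional that vanishes on `v i n` for `p`-almost all `n`, for every `i`,
and has value `1` at infinitely many points of a given infinite set. -/
theorem IsSelective.exists_functional {p : Ultrafilter ℕ} (hp : IsSelective p)
    {K V : Type*} [Field K] [Finite K] [AddCommGroup V] [Module K V] [Countable V]
    (v : ℕ → ℕ → V)
    (hv : ∀ (k : ℕ) (c : Fin k → K) (e : V),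
      (∀ᶠ n in (p : Filter ℕ), ∑ i : Fin k, c i • v i n = e) → e = 0)
    (X : Set V) (hX : X.Infinite) :
    ∃ ψ : V →ₗ[K] K, (∀ i, ∀ᶠ n in (p : Filter ℕ), ψ (v i n) = 0) ∧
      {x | x ∈ X ∧ ψ x = 1}.Infinite := by
  classical
  obtain ⟨enum, henum⟩ := exists_surjective_nat V
  -- A state: the round, the finite subspace where the functional is settled, and the current
  -- functional.
  let σ := ℕ × {E : Submodule K V // Module.Finite K E} × (V →ₗ[K] K)
  let R : ℕ → ℕ → Submodule K V := fun k n => Submodule.span K (Set.range fun i : Fin k => v i n)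
  let W : σ → Set ℕ := fun s => {n | Disjoint s.2.1.1 (R s.1 n)}
  have hW : ∀ s, W s ∈ p := by
    rintro ⟨k, ⟨E, hE⟩, ψ⟩
    have hEfin : Finite E := Module.finite_of_finite K
    -- `K` and `E` are finite, so only finitely many pairs `(c, e)` need be avoided.
    have h1 : ∀ᶠ n in (p : Filter ℕ), ∀ (c : Fin k → K) (e : E),
        ∑ i, c i • v i n = e → (e : V) = 0 := by
      refine eventually_all.2 fun c => eventually_all.2 fun e => ?_
      by_cases he : (e : V) = 0
      · exact Eventually.of_forall fun _ _ => he
      · refine (Ultrafilter.eventually_not.2 fun h => he (hv k c e h)).mono fun n hn h => ?_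
        exact absurd h hn
    refine h1.mono fun n hn => Submodule.disjoint_def.2 fun x hxE hxR => ?_
    obtain ⟨c, hc⟩ := (Submodule.mem_span_range_iff_exists_fun K).1 hxR
    exact hn c ⟨x, hxE⟩ hc
  have hstep : ∀ (s : σ) (n : ℕ), ∃ s' : σ, n ∈ W s →
      s'.1 = s.1 + 1 ∧ s.2.1.1 ≤ s'.2.1.1 ∧ enum s.1 ∈ s'.2.1.1 ∧
      (∀ x ∈ s.2.1.1, s'.2.2 x = s.2.2 x) ∧
      (∀ i < s.1, v i n ∈ s'.2.1.1 ∧ s'.2.2 (v i n) = 0) ∧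
      ∃ x ∈ X, x ∉ s.2.1.1 ∧ x ∈ s'.2.1.1 ∧ s'.2.2 x = 1 := by
    rintro ⟨k, ⟨E, hE⟩, ψ⟩ n
    by_cases hn : (⟨k, ⟨E, hE⟩, ψ⟩ : σ) ∈ {s : σ | n ∈ W s}
    swap
    · exact ⟨⟨k, ⟨E, hE⟩, ψ⟩, fun h => absurd h hn⟩
    have hRf : Module.Finite K (R k n) := FiniteDimensional.span_of_finite K (Set.finite_range _)
    have hsup : Finite (E ⊔ R k n : Submodule K V) := Module.finite_of_finite K
    obtain ⟨x, hxX, hx⟩ := (hX.sdiff (Set.toFinite (E ⊔ R k n : Submodule K V).carrier)).nonempty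
    obtain ⟨ψ', h1, h2, h3⟩ := exists_functional_extending E (R k n) hn hx ψ
    -- Adding `enum k` makes the subspaces exhaust `V`; adding `x` fixes the value 1 at a new point
    -- of `X`.
    let E' := E ⊔ R k n ⊔ (Submodule.span K {enum k} ⊔ Submodule.span K {x})
    have hE' : Module.Finite K E' := inferInstance
    have hle : E ⊔ R k n ≤ E' := le_sup_left
    refine ⟨⟨k + 1, ⟨E', hE'⟩, ψ'⟩, fun _ => ⟨rfl, le_sup_left.trans hle, ?_, h1, ?_, x, hxX,
      fun h => hx (Submodule.mem_sup_left h), ?_, h3⟩⟩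
    · exact Submodule.mem_sup_right (Submodule.mem_sup_left (Submodule.mem_span_singleton_self _))
    · intro i hi
      have hvi : v i n ∈ R k n := Submodule.subset_span ⟨⟨i, hi⟩, rfl⟩
      exact ⟨hle (Submodule.mem_sup_right hvi), h2 _ hvi⟩
    · exact Submodule.mem_sup_right (Submodule.mem_sup_right (Submodule.mem_span_singleton_self _))
  choose step hstep using hstep
  obtain ⟨u, s, hu, hup, hs0, hs, huW⟩ :=
    hp.exists_play step W hW ⟨0, ⟨⊥, inferInstance⟩, 0⟩
  have hS : ∀ k, _ := fun k => hstep (s k) (u k) (huW k)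
  simp only [← hs] at hS
  have hk : ∀ k, (s k).1 = k := by
    intro k
    induction k with
    | zero => rw [hs0]
    | succ k ih => rw [(hS k).1, ih]
  simp only [hk] at hS
  have hmono : Monotone fun k => (s k).2.1.1 := monotone_nat_of_le_succ fun k => (hS k).2.1
  obtain ⟨ψ, hψ⟩ := exists_functional_of_stabilizing (fun k => (s k).2.1.1) hmono
    (fun x => by
      obtain ⟨k, rfl⟩ := henum x
      exact ⟨k + 1, (hS k).2.2.1⟩)
    (fun k => (s k).2.2) fun k => (hS k).2.2.2.1
  refine ⟨ψ, fun i => ?_, ?_⟩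
  · have hbig : ∀ᶠ n in (p : Filter ℕ), u i < n :=
      (Nat.cofinite_eq_atTop ▸ hp.free) (eventually_gt_atTop (u i))
    filter_upwards [hup, hbig] with n ⟨k, hk'⟩ hn
    subst hk'
    obtain ⟨h1, h2⟩ := (hS k).2.2.2.2.1 i (hu.lt_iff_lt.1 hn)
    rw [hψ (k + 1) _ h1, h2]
  · choose x hxX hxn hx hx1 using fun k => (hS k).2.2.2.2.2
    have hinj : Function.Injective x := by
      have : ∀ k l, k < l → x k ≠ x l := fun k l hkl h =>
        hxn l (h ▸ hmono (Nat.succ_le_of_lt hkl) (hx k))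
      intro k l h
      by_contra hne
      rcases Nat.lt_or_gt_of_ne hne with hlt | hlt
      · exact this _ _ hlt h
      · exact this _ _ hlt h.symm
    refine (Set.infinite_range_of_injective hinj).mono ?_
    rintro _ ⟨k, rfl⟩
    exact ⟨hxX k, by rw [hψ (k + 1) _ (hx k), hx1]⟩

/-! ### Elements of the iterated ultrapowers as `p`-limits -/

section Ult

variable {I : Type} [LinearOrder I] [WellFoundedLT I]
variable {p : Ultrafilter ℕ} {G : Type} [AddCommGroup G]

/-- The value of `v : ult i` as a function of the homomorphism `Φ`. -/
def evalHom (p : Ultrafilter ℕ) (G : Type) [AddCommGroup G] (i : I) :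
    ult p G i →+ ((G →+ UnitAddCircle) → UnitAddCircle) :=
  AddMonoidHom.pi fun Φ => ext p Φ i

@[simp]
theorem evalHom_apply (i : I) (v : ult p G i) (Φ : G →+ UnitAddCircle) :
    evalHom p G i v Φ = ext p Φ i v := rfl

theorem limExt_toLim (Φ : G →+ UnitAddCircle) {i : I} (j : {j // j < i}) (a : ult p G j.1) :
    limExt p G i _ (compat_ext p Φ i) (toLim p G i j a) = ext p Φ j.1 a :=
  AddCommGroup.DirectLimit.lift_of ..

/-- Every element of `ult i` is a `p`-limit of elements of earlier stages. -/
theorem exists_tendsto_evalHom {i : I} (hi : ¬ IsMin i) (v : ult p G i) :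
    ∃ (j : ℕ → I) (w : ∀ n, ult p G (j n)), (∀ n, j n < i) ∧
      Tendsto (fun n => evalHom p G (j n) (w n)) p (𝓝 (evalHom p G i v)) := by
  obtain ⟨f, hf⟩ := Quotient.exists_rep (ultEquiv p G hi v)
  have hv : v = (ultEquiv p G hi).symm (f : Ultrapower p (ultLim p G i)) := by
    rw [AddEquiv.eq_symm_apply]
    exact hf.symm
  obtain ⟨b, hb⟩ := not_isMin_iff.1 hi
  have : Nonempty {j // j < i} := ⟨⟨b, hb⟩⟩
  have hex : ∀ n, ∃ (j : {j // j < i}) (w : ult p G j.1), toLim p G i j w = f n := fun n =>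
    AddCommGroup.DirectLimit.induction_on (f n) fun j w => ⟨j, w, rfl⟩
  choose j w hw using hex
  refine ⟨fun n => (j n).1, w, fun n => (j n).2, tendsto_pi_nhds.2 fun Φ => ?_⟩
  simp only [evalHom_apply, ← limExt_toLim, hw]
  rw [hv, ext_of_not_isMin]
  exact tendsto_limUnder _ _

/-- Every sequence of elements of stages before `i` has a `p`-limit in `ult i`. -/
theorem exists_evalHom_tendsto {i : I} (j : ℕ → I) (hj : ∀ n, j n < i)
    (w : ∀ n, ult p G (j n)) :
    ∃ v : ult p G i, Tendsto (fun n => evalHom p G (j n) (w n)) p (𝓝 (evalHom p G i v)) := by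
  have hi : ¬ IsMin i := (hj 0).not_isMin
  refine ⟨(ultEquiv p G hi).symm
    ((fun n => toLim p G i ⟨j n, hj n⟩ (w n) : ℕ → ultLim p G i) : Ultrapower p (ultLim p G i)),
    tendsto_pi_nhds.2 fun Φ => ?_⟩
  simp only [evalHom_apply]
  rw [ext_of_not_isMin]
  refine (tendsto_limUnder _ _).congr fun n => ?_
  exact limExt_toLim Φ ⟨j n, hj n⟩ (w n)

theorem evalHom_φ {j i : I} (hji : j < i) (a : ult p G j) :
    evalHom p G i (φ p G j i a) = evalHom p G j a := by
  funext Φ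
  change ext p Φ i (φ p G j i a) = ext p Φ j a
  rw [ext_eq p Φ i, dif_neg hji.not_isMin, dif_pos (compat_ext p Φ i)]
  change ultrapowerExt p _ (ultEquiv p G hji.not_isMin (φ p G j i a)) = _
  rw [ultEquiv_φ p G hji, ultrapowerExt_const]
  exact limExt_toLim Φ ⟨j, hji⟩ a

/-- The identity `x + x = 0` is preserved by `p`-limits. -/
theorem evalHom_add_self (hG : ∀ g : G, g + g = 0) (i : I) (v : ult p G i) :
    evalHom p G i v + evalHom p G i v = 0 := by
  induction i using WellFoundedLT.induction with
  | _ i ih =>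
    by_cases hi : IsMin i
    · funext Φ
      simp [ext_of_isMin p Φ hi, ← map_add, hG]
    · obtain ⟨j, w, hj, hw⟩ := exists_tendsto_evalHom hi v
      refine tendsto_nhds_unique (hw.add hw) ?_
      simp only [ih _ (hj _)]
      exact tendsto_const_nhds

end Ult

/-! ### Countable subgroups closed under countably many operations -/

/-- Used to keep the chosen approximating sequences inside a countable group. -/
theorem exists_countable_addSubgroup_closed {M : Type*} [AddCommGroup M] {X : Set M}
    (hX : X.Countable) (F : ℕ → M → M) :
    ∃ S : AddSubgroup M, X ⊆ S ∧ (S : Set M).Countable ∧ ∀ n, ∀ s ∈ S, F n s ∈ S := by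
  let T : ℕ → Set M := fun k =>
    Nat.rec (insert 0 X) (fun _ t => (t ∪ Set.image2 (fun x y => x + -y) t t) ∪ ⋃ n, F n '' t) k
  have hT : ∀ k, T (k + 1) =
      (T k ∪ Set.image2 (fun x y => x + -y) (T k) (T k)) ∪ ⋃ n, F n '' T k := fun k => rfl
  have hmono : Monotone T := monotone_nat_of_le_succ fun k => by
    rw [hT]; exact Set.subset_union_left.trans Set.subset_union_left
  have hcount : ∀ k, (T k).Countable := by
    intro k
    induction k with
    | zero => exact hX.insert 0
    | succ k ih =>
      rw [hT]
      exact (ih.union (ih.image2 ih _)).union (Set.countable_iUnion fun n => ih.image _)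
  refine ⟨AddSubgroup.ofSub (⋃ k, T k) ⟨0, Set.mem_iUnion.2 ⟨0, Set.mem_insert _ _⟩⟩ ?_,
    fun x hx => Set.mem_iUnion.2 ⟨0, Set.mem_insert_of_mem _ hx⟩, Set.countable_iUnion hcount, ?_⟩
  · intro x hx y hy
    obtain ⟨k, hk⟩ := Set.mem_iUnion.1 hx
    obtain ⟨l, hl⟩ := Set.mem_iUnion.1 hy
    refine Set.mem_iUnion.2 ⟨max k l + 1, ?_⟩
    rw [hT]
    exact Or.inl (Or.inr (Set.mem_image2_of_mem (hmono (le_max_left _ _) hk)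
      (hmono (le_max_right _ _) hl)))
  · intro n s hs
    obtain ⟨k, hk⟩ := Set.mem_iUnion.1 hs
    refine Set.mem_iUnion.2 ⟨k + 1, ?_⟩
    rw [hT]
    exact Or.inr (Set.mem_iUnion.2 ⟨n, Set.mem_image_of_mem _ hk⟩)

/-! ### Separating infinitely many elements from zero -/

theorem two_zsmul_half :
    (zmultiplesHom UnitAddCircle) ((1 / 2 : ℝ) : UnitAddCircle) (2 : ℕ) = 0 := by
  simp only [zmultiplesHom_apply, Nat.cast_ofNat]
  rw [ofNat_zsmul, ← AddCircle.coe_nsmul]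
  simp

/-- The embedding of `ℤ/2` into `ℝ/ℤ`. -/
def zmodTwoToCircle : ZMod 2 →+ UnitAddCircle :=
  ZMod.lift 2 ⟨(zmultiplesHom UnitAddCircle) ((1 / 2 : ℝ) : UnitAddCircle), two_zsmul_half⟩

theorem zmodTwoToCircle_one_ne_zero : zmodTwoToCircle 1 ≠ 0 := by
  have h : zmodTwoToCircle 1 = ((1 / 2 : ℝ) : UnitAddCircle) := by
    simpa [zmodTwoToCircle] using ZMod.lift_coe 2 (A := UnitAddCircle)
      ⟨(zmultiplesHom UnitAddCircle) ((1 / 2 : ℝ) : UnitAddCircle), two_zsmul_half⟩ 1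
  rw [h, Ne, AddCircle.coe_eq_zero_iff_of_mem_Ico (by norm_num)]
  norm_num

section Separation

variable {I : Type} [LinearOrder I] [WellFoundedLT I]
variable {p : Ultrafilter ℕ} {G : Type} [AddCommGroup G]

/-- For every infinite countable set of (values of) elements of the iterated ultrapowers of a
countable Boolean group there is a homomorphism `Φ` such that `Φ̄` has value `1/2` at infinitely
many of them. -/
theorem IsSelective.exists_hom_ne_zero (hp : IsSelective p) [Countable G]
    (hG : ∀ g : G, g + g = 0) {i : I}
    (X : Set ((G →+ UnitAddCircle) → UnitAddCircle)) (hXc : X.Countable) (hXinf : X.Infinite)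
    (hX : ∀ x ∈ X, ∃ v : ult p G i, evalHom p G i v = x) :
    ∃ Φ : G →+ UnitAddCircle, {x | x ∈ X ∧ x Φ = zmodTwoToCircle 1}.Infinite := by
  classical
  let M := (G →+ UnitAddCircle) → UnitAddCircle
  let A : I → AddSubgroup M := fun j => (evalHom p G j).range
  have hA2 : ∀ j, ∀ x ∈ A j, x + x = 0 := by
    rintro j _ ⟨v, rfl⟩
    exact evalHom_add_self hG j v
  have hmono : Monotone A := by
    intro j k hjk
    rcases hjk.eq_or_lt with rfl | hjk
    · exact le_rfl
    · rintro _ ⟨v, rfl⟩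
      exact ⟨φ p G j k v, evalHom_φ hjk v⟩
  let ev : G →+ M := AddMonoidHom.pi fun Φ => Φ
  obtain ⟨j₀, -, hj₀⟩ := WellFounded.has_min (wellFounded_lt (α := I)) Set.univ ⟨i, trivial⟩
  have hj₀ : ∀ j, j₀ ≤ j := fun j => not_lt.1 (hj₀ j trivial)
  have hevA : ∀ g, ev g ∈ A j₀ := fun g => by
    have hmin : IsMin j₀ := fun j _ => hj₀ j
    refine ⟨(ultEquivBot p G hmin).symm g, funext fun Φ => ?_⟩
    rw [evalHom_apply, ext_of_isMin p Φ hmin, AddEquiv.apply_symm_apply]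
    rfl
  -- Approximating at the least stage where `x` occurs gives one sequence valid for every `j`;
  -- depending on `x` alone, it amounts to countably many operations on `M`.
  have happrox : ∀ x : M, ∃ f : ℕ → M, ∀ j, x ∈ A j →
      x ∈ ev.range ∨ (Tendsto f p (𝓝 x) ∧ ∀ n, ∃ k < j, f n ∈ A k) := by
    intro x
    by_cases hx : ∃ j, x ∈ A j
    swap
    · exact ⟨fun _ => x, fun j hj => absurd ⟨j, hj⟩ hx⟩
    obtain ⟨j, ⟨v, hv⟩, hjmin⟩ := WellFounded.has_min (wellFounded_lt (α := I)) {j | x ∈ A j} hx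
    by_cases hj : IsMin j
    · refine ⟨fun _ => x, fun _ _ => Or.inl ⟨ultEquivBot p G hj v, funext fun Φ => ?_⟩⟩
      rw [← hv, evalHom_apply, ext_of_isMin p Φ hj]
      rfl
    · obtain ⟨k, w, hk, hw⟩ := exists_tendsto_evalHom hj v
      exact ⟨fun n => evalHom p G (k n) (w n), fun l hl => Or.inr ⟨hv ▸ hw,
        fun n => ⟨k n, (hk n).trans_le (not_lt.1 (hjmin l hl)), w n, rfl⟩⟩⟩
  choose f hf using happrox
  obtain ⟨S₀, hXS₀, hS₀c, hS₀f⟩ := exists_countable_addSubgroup_closed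
    (hXc.union (Set.countable_range ev)) fun n x => f x n
  -- Intersecting with `A i` makes every element have order at most 2.
  let S : AddSubgroup M := S₀ ⊓ A i
  have hevS : ∀ g, ev g ∈ S := fun g =>
    ⟨hXS₀ (Or.inr ⟨g, rfl⟩), hmono (hj₀ i) (hevA g)⟩
  have hXS : X ⊆ S := fun x hx => ⟨hXS₀ (Or.inl hx), hX x hx⟩
  have hfS : ∀ s ∈ S, s ∉ ev.range → ∀ n, f s n ∈ S := fun s hs hse n => by
    obtain ⟨k, hk, hkf⟩ := ((hf s i hs.2).resolve_left hse).2 n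
    exact ⟨hS₀f n s hs.1, hmono hk.le hkf⟩
  have : Countable S := (hS₀c.mono fun _ h => h.1).to_subtype
  let _ : Module (ZMod 2) S := AddCommGroup.zmodModule fun s => by
    rw [two_nsmul]
    exact Subtype.ext (hA2 i s s.2.2)
  obtain ⟨enum, henum⟩ := exists_surjective_nat S
  let v : ℕ → ℕ → S := fun m n =>
    if h : (enum m : M) ∈ ev.range then 0 else ⟨f (enum m) n, hfS _ (enum m).2 h n⟩ - enum m
  have hv : ∀ m, Tendsto (fun n => (v m n : M)) p (𝓝 0) := fun m => by
    by_cases h : (enum m : M) ∈ ev.range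
    · simp only [v, dif_pos h]
      exact tendsto_const_nhds
    · simp only [v, dif_neg h]
      have := ((hf _ i (enum m).2.2).resolve_left h).1.sub_const (enum m : M)
      rwa [sub_self] at this
  have hcv : ∀ (c : ZMod 2) m, Tendsto (fun n => ((c • v m n : S) : M)) p (𝓝 0) := by
    intro c m
    have hc : c = 0 ∨ c = 1 := by revert c; decide
    rcases hc with rfl | rfl
    · simp only [zero_smul]
      exact tendsto_const_nhds
    · simpa only [one_smul] using hv m
  -- Linear combinations of the `v m` tend to 0 along `p`, so one that is `p`-almost everywhere
  -- constant is 0 there.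
  obtain ⟨ψ, hψ, hψX⟩ := hp.exists_functional (K := ZMod 2) v (fun k c e he => by
    have h1 : Tendsto (fun n => ((∑ m : Fin k, c m • v m n : S) : M)) p (𝓝 0) := by
      have := tendsto_finsetSum (Finset.univ : Finset (Fin k)) fun m _ => hcv (c m) m
      simpa only [Finset.sum_const_zero, AddSubgroup.val_finsetSum] using this
    refine Subtype.ext (tendsto_nhds_unique (tendsto_const_nhds.congr' ?_) h1)
    filter_upwards [he] with n hn
    rw [hn]) ((↑) ⁻¹' X : Set S) (hXinf.preimage (by simpa using hXS))
  let Φ : G →+ UnitAddCircle :=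
    (zmodTwoToCircle.comp ψ.toAddMonoidHom).comp (ev.codRestrict S hevS)
  -- `Φ` is itself a coordinate of `M`. Outside the image of `G`, evaluate `s = p-lim f s n` there:
  -- by induction the terms are `zmodTwoToCircle (ψ (f s n))`, which is `p`-almost everywhere
  -- `zmodTwoToCircle (ψ s)`.
  have hΦ : ∀ j, ∀ s : S, (s : M) ∈ A j → (s : M) Φ = zmodTwoToCircle (ψ s) := by
    intro j
    induction j using WellFoundedLT.induction with
    | _ j ih =>
      intro s hs
      by_cases hse : (s : M) ∈ ev.range
      · obtain ⟨g, hg⟩ := hse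
        have : s = ⟨ev g, hevS g⟩ := Subtype.ext hg.symm
        subst this
        rfl
      · obtain ⟨hlim, hlt⟩ := (hf s j hs).resolve_left hse
        refine tendsto_nhds_unique (tendsto_pi_nhds.1 hlim Φ) ?_
        obtain ⟨m, rfl⟩ := henum s
        refine tendsto_const_nhds.congr' ?_
        filter_upwards [hψ m] with n hn
        simp only [v, dif_neg hse, map_sub, sub_eq_zero] at hn
        obtain ⟨k, hk, hkf⟩ := hlt n
        rw [← hn, ← ih k hk ⟨f (enum m) n, _⟩ hkf]
  refine ⟨Φ, (hψX.image Subtype.val_injective.injOn).mono ?_⟩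
  rintro _ ⟨s, ⟨hsX, hs⟩, rfl⟩
  exact ⟨hsX, by rw [hΦ i s s.2.2, hs]⟩

end Separation

/-! ### The group `Ult_p^{ω₁}(G)` as a group of functions -/

/-- Every countable set of ordinals below `ω₁` is strictly bounded below `ω₁`. -/
theorem exists_lt_top_forall_lt (j : ℕ → OmegaOneIndex) (hj : ∀ n, j n < ⊤) :
    ∃ k : OmegaOneIndex, k < ⊤ ∧ ∀ n, j n < k := by
  choose a ha using fun n => WithTop.ne_top_iff_exists.1 (hj n).ne
  have hc : ∀ b : (Ordinal.omega 1 : Ordinal.{0}).ToType, (Set.Iic b).Countable := fun b => by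
    have h1 : (Set.Iio b).Countable := by
      rw [← Cardinal.le_aleph0_iff_set_countable, ← Order.lt_succ_iff, Cardinal.succ_aleph0]
      have h2 := Ordinal.typein_lt_type (α := (Ordinal.omega 1 : Ordinal.{0}).ToType) (· < ·) b
      rw [Ordinal.type_toType] at h2
      have h3 := Cardinal.lt_ord.1 (h2.trans_eq (Cardinal.ord_aleph 1).symm)
      exact h3
    rw [← Set.Iio_insert]
    exact h1.insert b
  -- Countably many countable initial segments cannot cover the uncountable `ω₁`.
  have hne : (⋃ n, Set.Iic (a n)) ≠ Set.univ := fun h => by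
    have h1 : (Set.univ : Set (Ordinal.omega 1 : Ordinal.{0}).ToType).Countable :=
      h ▸ Set.countable_iUnion fun n => hc (a n)
    rw [← Cardinal.le_aleph0_iff_set_countable, Cardinal.mk_univ, Cardinal.mk_toType,
      Ordinal.card_omega] at h1
    exact h1.not_gt Cardinal.aleph0_lt_aleph_one
  obtain ⟨b, hb⟩ := (Set.ne_univ_iff_exists_notMem _).1 hne
  refine ⟨b, WithTop.coe_lt_top b, fun n => ?_⟩
  rw [← ha n, WithTop.coe_lt_coe]
  exact not_le.1 fun h => hb (Set.mem_iUnion.2 ⟨n, h⟩)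

theorem not_isMin_top : ¬ IsMin (⊤ : OmegaOneIndex) := by
  have : Nonempty (Ordinal.omega 1 : Ordinal.{0}).ToType := by
    rw [Ordinal.nonempty_toType_iff]
    exact (Ordinal.omega_pos 1).ne'
  exact (WithTop.coe_lt_top (Classical.arbitrary _)).not_isMin

variable {p : Ultrafilter ℕ} {G : Type} [AddCommGroup G]

theorem mem_commonKernel {x : UltOmegaOne p G} :
    x ∈ commonKernel p G ↔ evalHom p G (⊤ : OmegaOneIndex) x = 0 := by
  simp only [commonKernel, AddSubgroup.mem_iInf, AddMonoidHom.mem_ker, funext_iff]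
  rfl

/-- The injective homomorphism `Ult_p^{ω₁}(G) → 𝕋^{Hom(G, 𝕋)}`. -/
def hausdorffEval (p : Ultrafilter ℕ) (G : Type) [AddCommGroup G] :
    HausdorffUlt p G →+ ((G →+ UnitAddCircle) → UnitAddCircle) :=
  QuotientAddGroup.lift (commonKernel p G) (evalHom p G (⊤ : OmegaOneIndex))
    fun _ hx => mem_commonKernel.1 hx

theorem hausdorffEval_mk (x : UltOmegaOne p G) :
    hausdorffEval p G (x : HausdorffUlt p G) = evalHom p G (⊤ : OmegaOneIndex) x := rfl

theorem hausdorffEval_injective : Function.Injective (hausdorffEval p G) := by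
  rw [injective_iff_map_eq_zero]
  intro x hx
  obtain ⟨x, rfl⟩ := QuotientAddGroup.mk_surjective x
  exact (QuotientAddGroup.eq_zero_iff x).2 (mem_commonKernel.2 hx)

/-- The topology upstairs is induced by `evalHom`, whose kernel is `K`; thus its open sets are
saturated and the quotient topology is again the induced one. -/
theorem isEmbedding_hausdorffEval : IsEmbedding (hausdorffEval p G) := by
  refine ⟨⟨TopologicalSpace.ext_iff.2 fun s => ?_⟩, hausdorffEval_injective⟩
  have hind : IsInducing fun x : UltOmegaOne p G => evalHom p G (⊤ : OmegaOneIndex) x :=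
    inducing_iInf_to_pi fun Φ => extOmegaOne p Φ
  rw [isOpen_induced_iff]
  have hq : IsOpen s ↔ IsOpen ((QuotientAddGroup.mk : UltOmegaOne p G → HausdorffUlt p G) ⁻¹' s) :=
    Iff.rfl
  rw [hq, hind.isOpen_iff]
  refine exists_congr fun t => and_congr_right fun _ => ?_
  rw [← QuotientAddGroup.mk_surjective.preimage_injective.eq_iff]
  rfl

/-- A sequence representing `v` uses stages bounded by some `k < ω₁`, so its `p`-limit already
occurs in `ult k`. -/
theorem exists_earlier_evalHom_eq (v : ult p G (⊤ : OmegaOneIndex)) :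
    ∃ (k : OmegaOneIndex) (_ : k < ⊤) (u : ult p G k),
      evalHom p G k u = evalHom p G (⊤ : OmegaOneIndex) v := by
  obtain ⟨j, w, hj, hw⟩ := exists_tendsto_evalHom not_isMin_top v
  obtain ⟨k, hk, hjk⟩ := exists_lt_top_forall_lt j hj
  obtain ⟨u, hu⟩ := exists_evalHom_tendsto j hjk w
  exact ⟨k, hk, u, tendsto_nhds_unique hu hw⟩

/-- Once the terms are moved to stages below `ω₁`, the class of the sequence is an element of the
last stage. -/
theorem isPCompact_hausdorffUlt : IsPCompact p (HausdorffUlt p G) := by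
  intro x
  choose v hv using fun n => QuotientAddGroup.mk_surjective (x n)
  choose k hk u hu using fun n => exists_earlier_evalHom_eq (v n)
  obtain ⟨a, ha⟩ := exists_evalHom_tendsto k hk u
  refine ⟨QuotientAddGroup.mk (s := commonKernel p G) a,
    isEmbedding_hausdorffEval.tendsto_nhds_iff.2 (ha.congr fun n => ?_)⟩
  rw [hu, Function.comp_apply, ← hv n]
  rfl

theorem IsSelective.noNontrivialConvergentSeq (hp : IsSelective p) [Countable G]
    (hG : ∀ g : G, g + g = 0) : NoNontrivialConvergentSeq (HausdorffUlt p G) := by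
  intro x a hx
  by_contra hne
  have hconv : Tendsto (fun n => hausdorffEval p G (x n - a)) atTop (𝓝 0) := by
    have := (isEmbedding_hausdorffEval.tendsto_nhds_iff.1 hx).sub_const (hausdorffEval p G a)
    simpa only [Function.comp_def, ← map_sub, sub_self, map_zero] using this
  set y := fun n => hausdorffEval p G (x n - a) with hy
  have hN : {n | y n ≠ 0}.Infinite := by
    refine Nat.frequently_atTop_iff_infinite.1 fun h => hne (h.mono fun n hn => ?_)
    exact sub_eq_zero.1 (hausdorffEval_injective ((not_not.1 hn).trans (map_zero _).symm))
  have hfin : ∀ c, c ≠ 0 → {n | y n = c}.Finite := fun c hc => by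
    by_contra h
    refine hc ((isClosed_singleton (x := c)).mem_of_frequently_of_tendsto
      (Nat.frequently_atTop_iff_infinite.2 h) hconv).symm
  -- Each nonzero value is taken only finitely often, so infinitely many nonzero terms have
  -- infinitely many values.
  have hXinf : (y '' {n | y n ≠ 0}).Infinite := fun h => by
    refine hN ((h.biUnion (t := fun c => {n | y n = c ∧ c ≠ 0}) fun c _ => ?_).subset
      fun n hn => Set.mem_biUnion (Set.mem_image_of_mem y hn) ⟨rfl, hn⟩)
    by_cases hc : c = 0
    · simp [hc]
    · exact (hfin c hc).subset fun n hn => hn.1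
  obtain ⟨Φ, hΦ⟩ := hp.exists_hom_ne_zero hG (i := (⊤ : OmegaOneIndex)) _
    ((Set.to_countable {n | y n ≠ 0}).image y) hXinf (by
      rintro _ ⟨n, -, rfl⟩
      obtain ⟨v, hv⟩ := QuotientAddGroup.mk_surjective (x n - a)
      exact ⟨v, congrArg (hausdorffEval p G) hv⟩)
  have hΦ' : {n | y n Φ = zmodTwoToCircle 1}.Infinite := fun h => by
    refine hΦ ((h.image y).subset ?_)
    rintro _ ⟨⟨n, -, rfl⟩, hn⟩
    exact ⟨n, hn, rfl⟩
  exact zmodTwoToCircle_one_ne_zero ((isClosed_singleton.mem_of_frequently_of_tendsto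
    (Nat.frequently_atTop_iff_infinite.2 hΦ') (tendsto_pi_nhds.1 hconv Φ)).symm)

theorem finSubsets_add_self (g : FinSubsets) : g + g = 0 := symmDiff_self (ofBoolRing g)

instance : Countable FinSubsets := inferInstanceAs (Countable (Finset ℕ))

end IteratedUltrapower

end

theorem theorem3p3 (p : Ultrafilter ℕ) (hp : IteratedUltrapower.IsSelective p) :
    IsTopologicalAddGroup (IteratedUltrapower.HausdorffUlt p IteratedUltrapower.FinSubsets) ∧
    T2Space (IteratedUltrapower.HausdorffUlt p IteratedUltrapower.FinSubsets) ∧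
    (∀ x : IteratedUltrapower.HausdorffUlt p IteratedUltrapower.FinSubsets, x + x = 0) ∧
    IteratedUltrapower.IsPCompact p
      (IteratedUltrapower.HausdorffUlt p IteratedUltrapower.FinSubsets) ∧
    IteratedUltrapower.NoNontrivialConvergentSeq
      (IteratedUltrapower.HausdorffUlt p IteratedUltrapower.FinSubsets) := by
  open IteratedUltrapower in
  refine ⟨isEmbedding_hausdorffEval.isInducing.topologicalAddGroup (hausdorffEval p FinSubsets),
    isEmbedding_hausdorffEval.t2Space, fun x => ?_, isPCompact_hausdorffUlt,
    hp.noNontrivialConvergentSeq finSubsets_add_self⟩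
  obtain ⟨v, rfl⟩ := QuotientAddGroup.mk_surjective x
  apply hausdorffEval_injective
  rw [map_add, map_zero, hausdorffEval_mk]
  exact evalHom_add_self finSubsets_add_self _ v
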